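/- Let $p$ be a prime, let $h\in\mathbb Z[t]$ be monic and irreducible modulo $p$, put $R=\mathbb Z[t]/(h)$ and, for $e\ge 1$, let $R_e=R/(p^e)$ (a Galois ring, with residue field $R_1$) with canonical map $\pi_e:R\to R_e$, extended to polynomials. For a polynomial $g$ over $R$ or over $R_e$ write $\bar g\in R_1[x]$ for its reduction modulo $p$. For a self-map $\Gamma$ of a finite set let $\mathcal C(\Gamma)$ be the set of lengths of the cycles of its functional graph. For $f,m\in R[x]$ let $\Gamma_e(f,m)$ be the map $g\mapsto \pi_e(f)g$ on $R_e[x]/(\pi_e(m))$. For coprime polynomials $F,g$ over $R_e$, let $\mathcal O(F,g)$ be the least positive integer $k$ with $F^k\equiv 1\pmod g$ (when such a $k$ exists, as it does below), and for $g\in R_e[x]$ write $\mathcal O_e(f,g)=\mathcal O(\pi_e(f),g)$. For sets $A,B$ of positive integers let $A\odot B=\{\operatorname{lcm}(a,b): a\in A,\ b\in B\}$; the empty $\odot$-product is $\{1\}$. **Theorem.** Let $f,m\in R[x]$ with $m$ monic and $1\le \deg f<\deg m$, and let $e>1$. Let $m_1,m_2\in R_e[x]$ with $\pi_e(m)=m_1m_2$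 be such that $\pi_e(f)$ is coprime to $m_1$ (they generate the unit ideal) and $\pi_e(f)\in\operatorname{rad}(m_2)$. Let $\bar m_1=\prod_{i=1}^r G_i^{k_i}$ with $k_i>0$ and pairwise coprime irreducible polynomials $G_i\in R_1[x]$. Call $G_i$ and $G_{i'}$ equivalent if the orders $\mathcal O(\bar f,G_i)$ and $\mathcal O(\bar f,G_{i'})$ differ by a power of $p$ (that is, one of them is $p^k$ times the other for some integer $k\ge 0$), let $B_1,\dots,B_\eta$ be the equivalence classes, and let $\Theta_j=\prod_{G_i\in B_j}G_i^{k_i}$. Let $\theta_1,\dots,\theta_\eta\in R_e[x]$ be such that $\bar\theta_j=\Theta_j$ for all $j$ and $m_1=\prod_{j=1}^\eta\theta_j$. Then $$\mathcal C(\Gamma_e(f,m))=\mathcal C(\Gamma_{e-1}(f,m))\ \cup\ \bigodot_{j=1}^{\eta}\{1,\mathcal O_e(f,\theta_j)\},$$ and $\eta\le r$. -/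

import Mathlib

open Polynomial

noncomputable section

/-! ## Finite dynamical systems -/

/-- The preperiod (transient length) of `x` under `Γ`: the least `τ` such that `Γ^τ x` lies on a
cycle. -/
def preperiod {X : Type*} (Γ : X → X) (x : X) : ℕ :=
  sInf {τ : ℕ | Γ^[τ] x ∈ Function.periodicPts Γ}

/-- The period (cycle length) of `x` under `Γ`: the length of the cycle that the orbit of `x`
enters, i.e. the least positive `ℓ` with `Γ^(τ+ℓ) x = Γ^τ x`, where `τ` is the preperiod. -/
def period {X : Type*} (Γ : X → X) (x : X) : ℕ :=
  Function.minimalPeriod Γ (Γ^[preperiod Γ x] x)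

/-- The set of cycle lengths of the system `(X, Γ)`. -/
def cycleSet {X : Type*} (Γ : X → X) : Set ℕ :=
  Set.range (period Γ)

/-- The multiplication-by-`f` map `g ↦ f g` on `S / I`. -/
def mulSystem {S : Type*} [CommRing S] (f : S) (I : Ideal S) : S ⧸ I → S ⧸ I :=
  fun g => f • g

/-- `I = I₁ I₂` is an `f`-decomposition of the ideal `I`: `f` is coprime with `I₁` and lies in the
radical of `I₂`. -/
structure IsFDecomposition {S : Type*} [CommRing S] (f : S) (I I₁ I₂ : Ideal S) : Prop where
  eq_mul : I = I₁ * I₂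
  coprime : I₁ ⊔ Ideal.span {f} = ⊤
  mem_radical : f ∈ I₂.radical

/-! ## Galois rings -/

/-- The ring `R = ℤ[t] / (h)`. -/
abbrev BaseRing (h : ℤ[X]) : Type := AdjoinRoot h

/-- The Galois ring `R_e = R / (p^e)`. -/
abbrev GaloisRing (p : ℕ) (h : ℤ[X]) (e : ℕ) : Type :=
  BaseRing h ⧸ Ideal.span {(p : BaseRing h) ^ e}

/-- The canonical homomorphism `π_e : R → R_e`. -/
abbrev canonicalHom (p : ℕ) (h : ℤ[X]) (e : ℕ) : BaseRing h →+* GaloisRing p h e :=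
  Ideal.Quotient.mk _

/-- The canonical reduction `R_e → R_e'` for `e' ≤ e`. -/
def reduction (p : ℕ) (h : ℤ[X]) {e' e : ℕ} (hle : e' ≤ e) :
    GaloisRing p h e →+* GaloisRing p h e' :=
  Ideal.Quotient.factor (Ideal.span_singleton_le_span_singleton.2 (pow_dvd_pow _ hle))

/-- The system `Γ_e(f, m)`: multiplication by `f` on `R_e[x] / (m)`, for `f, m ∈ R[x]`. -/
def galoisSystem (p : ℕ) (h : ℤ[X]) (e : ℕ) (f m : (BaseRing h)[X]) :
    (GaloisRing p h e)[X] ⧸ Ideal.span {m.map (canonicalHom p h e)} →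
      (GaloisRing p h e)[X] ⧸ Ideal.span {m.map (canonicalHom p h e)} :=
  mulSystem (f.map (canonicalHom p h e)) (Ideal.span {m.map (canonicalHom p h e)})

/-- The polynomial order `𝒪(f, g)`: the least positive `k` with `f^k ≡ 1 (mod g)`. -/
def polyOrder {S : Type*} [CommRing S] (f g : S[X]) : ℕ :=
  orderOf (Ideal.Quotient.mk (Ideal.span {g}) f)

/-! ## The order equivalence relation and the grouped factors -/

/-- Two polynomials are equivalent if their orders with respect to `F` differ by a power of `p`,
that is, one of the two orders is a power of `p` (possibly `p^0`) times the other. -/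
def OrderEquiv {S : Type*} [CommRing S] (p : ℕ) (F G₁ G₂ : S[X]) : Prop :=
  ∃ k : ℕ, polyOrder F G₁ = p ^ k * polyOrder F G₂ ∨ polyOrder F G₂ = p ^ k * polyOrder F G₁

theorem orderEquiv_iff {S : Type*} [CommRing S] (p : ℕ) [hp : Fact p.Prime] (F G₁ G₂ : S[X]) :
    OrderEquiv p F G₁ G₂ ↔
      ∃ a b : ℕ, p ^ a * polyOrder F G₁ = p ^ b * polyOrder F G₂ := by
  constructor
  · rintro ⟨k, hk | hk⟩
    · exact ⟨0, k, by simpa using hk⟩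
    · exact ⟨k, 0, by simpa using hk.symm⟩
  · rintro ⟨a, b, hab⟩
    rcases le_total a b with hle | hle
    · obtain ⟨c, rfl⟩ := Nat.exists_eq_add_of_le hle
      refine ⟨c, Or.inl (Nat.eq_of_mul_eq_mul_left (pow_pos hp.out.pos a) ?_)⟩
      rw [hab, pow_add, mul_assoc]
    · obtain ⟨c, rfl⟩ := Nat.exists_eq_add_of_le hle
      refine ⟨c, Or.inr (Nat.eq_of_mul_eq_mul_left (pow_pos hp.out.pos b) ?_)⟩
      rw [← hab, pow_add, mul_assoc]

/-- The order equivalence relation with respect to `F`. -/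
def orderSetoid {S : Type*} [CommRing S] (p : ℕ) [Fact p.Prime] (F : S[X]) : Setoid S[X] where
  r := OrderEquiv p F
  iseqv :=
    { refl := fun _ => ⟨0, Or.inl (by simp)⟩
      symm := fun ⟨k, hk⟩ => ⟨k, hk.symm⟩
      trans := fun {x y z} h₁ h₂ => by
        obtain ⟨a, b, hab⟩ := (orderEquiv_iff p F x y).1 h₁
        obtain ⟨c, d, hcd⟩ := (orderEquiv_iff p F y z).1 h₂
        refine (orderEquiv_iff p F x z).2 ⟨c + a, b + d, ?_⟩
        rw [pow_add, mul_assoc, hab, mul_left_comm, hcd, pow_add, mul_assoc] }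

/-- The set of classes of a family of polynomials `G₁, …, G_r` modulo the order equivalence
relation with respect to `F`. -/
abbrev OrderClass {S : Type*} [CommRing S] (p : ℕ) [Fact p.Prime] (F : S[X]) {r : ℕ}
    (G : Fin r → S[X]) : Type :=
  Quotient (Setoid.comap G (orderSetoid p F))

instance orderClassFintype {S : Type*} [CommRing S] (p : ℕ) [Fact p.Prime] (F : S[X]) {r : ℕ}
    (G : Fin r → S[X]) : Fintype (OrderClass p F G) :=
  Fintype.ofFinite _

open Classical in
/-- The grouped factor `Θ_j`: the product of the `G_i ^ k_i` over all `i` in the class `j`. -/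
def groupedFactor {S : Type*} [CommRing S] (p : ℕ) [Fact p.Prime] (F : S[X]) {r : ℕ}
    (G : Fin r → S[X]) (k : Fin r → ℕ) (j : OrderClass p F G) : S[X] :=
  ∏ i : Fin r with (Quotient.mk _ i : OrderClass p F G) = j, G i ^ k i

/-! ## The lcm-product of sets of natural numbers -/

/-- The lcm-product `A ⊙ B = {lcm(a, b) : a ∈ A, b ∈ B}`. -/
def lcmProd (A B : Set ℕ) : Set ℕ := Set.image2 Nat.lcm A B

/-- The lcm-product `⊙_{j ∈ s} K_j`, the set of all lcm's of families `(a_j)` with `a_j ∈ K_j`. -/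
def bigLcmProd {J : Type*} (s : Finset J) (K : J → Set ℕ) : Set ℕ :=
  {n : ℕ | ∃ a : J → ℕ, (∀ j ∈ s, a j ∈ K j) ∧ n = s.lcm a}

theorem bigLcmProd_empty {J : Type*} (K : J → Set ℕ) : bigLcmProd ∅ K = {1} := by
  ext n
  simp [bigLcmProd]

theorem bigLcmProd_insert {J : Type*} [DecidableEq J] (s : Finset J) (K : J → Set ℕ) (j : J)
    (hj : j ∉ s) : bigLcmProd (insert j s) K = lcmProd (K j) (bigLcmProd s K) := by
  ext n
  constructor
  · rintro ⟨a, ha, rfl⟩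
    refine ⟨a j, ha j (Finset.mem_insert_self j s), s.lcm a,
      ⟨a, fun i hi => ha i (Finset.mem_insert_of_mem hi), rfl⟩, ?_⟩
    rw [Finset.lcm_insert]
    rfl
  · rintro ⟨x, hx, y, ⟨a, ha, rfl⟩, rfl⟩
    have hne : ∀ i ∈ s, i ≠ j := fun i hi h => hj (h ▸ hi)
    refine ⟨Function.update a j x, ?_, ?_⟩
    · intro i hi
      rcases Finset.mem_insert.1 hi with rfl | hi
      · simpa using hx
      · simpa [Function.update_of_ne (hne i hi)] using ha i hi
    · rw [Finset.lcm_insert, Function.update_self,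
        Finset.lcm_congr (g := a) rfl (fun i hi => Function.update_of_ne (hne i hi) x a)]
      rfl

end

/-! ## Cycle lengths of multiplication maps -/

/-! A cycle length is the least period of a periodic point. Since `f` is nilpotent modulo `m₂`,
periodic points carry no information there, and only `m₁` matters
(`IsFDecomposition.cycleSet_eq_range`). By Chinese remaindering the lengths modulo `m₁` are the lcms
of lengths modulo the `θ j` (`range_minimalPeriod_iInf`).

Orders modulo irreducibles over the residue field are prime to `p`, so each class has one residual
order `d j`. Modulo `θ j`, `f ^ d j` is unipotent, while `f ^ n - 1` is a unit unless `d j ∣ n`.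
Hence the order of `f` is `d j * p ^ M j`, and the lengths are 1 and all `d j * p ^ s` with `s ≤ M
j` (`range_minimalPeriod_component`).

Passing from `e - 1` to `e` keeps `d j` and raises `M j` by at most one
(`polyOrder_dvd_mul_polyOrder_map`). An lcm of such lengths depends only on which entries differ
from 1 and on the largest exponent of `p`. So an lcm that is new at level `e` can be written with
every nontrivial entry equal to the full order (`bigLcmProd_eq_union`). -/

theorem cycleSet_eq_image {X : Type*} [Finite X] (Γ : X → X) :
    cycleSet Γ = Function.minimalPeriod Γ '' Function.periodicPts Γ := by
  have hmem (x : X) : Γ^[preperiod Γ x] x ∈ Function.periodicPts Γ := by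
    refine Nat.sInf_mem (s := {τ : ℕ | Γ^[τ] x ∈ Function.periodicPts Γ}) ?_
    obtain ⟨a, b, hab, h⟩ := Finite.exists_ne_map_eq_of_infinite (fun n : ℕ => Γ^[n] x)
    wlog hlt : a < b generalizing a b
    · exact this b a hab.symm h.symm (lt_of_le_of_ne (not_lt.1 hlt) hab.symm)
    refine ⟨a, Function.mk_mem_periodicPts (Nat.sub_pos_of_lt hlt) ?_⟩
    change Γ^[b - a] (Γ^[a] x) = Γ^[a] x
    rw [← Function.iterate_add_apply, Nat.sub_add_cancel hlt.le]
    exact h.symm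
  apply Set.Subset.antisymm
  · rintro _ ⟨x, rfl⟩
    exact ⟨_, hmem x, rfl⟩
  · rintro _ ⟨x, hx, rfl⟩
    have h0 : preperiod Γ x = 0 := Nat.sInf_eq_zero.2 (Or.inl hx)
    exact ⟨x, by simp [period, h0]⟩

section MulSystem

variable {S : Type*} [CommRing S]

theorem mulSystem_iterate (f : S) (I : Ideal S) (n : ℕ) (x : S ⧸ I) :
    (mulSystem f I)^[n] x = Ideal.Quotient.mk I f ^ n * x := by
  have h : mulSystem f I = fun x => Ideal.Quotient.mk I f * x := by
    funext x
    exact Algebra.smul_def f x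
  rw [h, mul_left_iterate]

theorem isPeriodicPt_mulSystem_iff (f : S) (I : Ideal S) (n : ℕ) (x : S ⧸ I) :
    Function.IsPeriodicPt (mulSystem f I) n x ↔ (Ideal.Quotient.mk I f ^ n - 1) * x = 0 := by
  rw [Function.IsPeriodicPt, Function.IsFixedPt, mulSystem_iterate, sub_mul, one_mul, sub_eq_zero]

theorem minimalPeriod_mulSystem_dvd_iff (f : S) (I : Ideal S) (n : ℕ) (x : S ⧸ I) :
    Function.minimalPeriod (mulSystem f I) x ∣ n ↔ (Ideal.Quotient.mk I f ^ n - 1) * x = 0 := by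
  rw [← Function.isPeriodicPt_iff_minimalPeriod_dvd, isPeriodicPt_mulSystem_iff]

theorem minimalPeriod_mulSystem_mk_dvd_iff (f : S) (I : Ideal S) (n : ℕ) (g : S) :
    Function.minimalPeriod (mulSystem f I) (Ideal.Quotient.mk I g) ∣ n ↔
      (f ^ n - 1) * g ∈ I := by
  rw [minimalPeriod_mulSystem_dvd_iff, ← Ideal.Quotient.eq_zero_iff_mem]
  simp

theorem isUnit_mk_of_sup_eq_top {f : S} {I : Ideal S} (h : I ⊔ Ideal.span {f} = ⊤) :
    IsUnit (Ideal.Quotient.mk I f) := by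
  obtain ⟨a, ha, b, hb, hab⟩ := Submodule.mem_sup.1 ((Ideal.eq_top_iff_one _).1 h)
  obtain ⟨c, rfl⟩ := Ideal.mem_span_singleton.1 hb
  refine IsUnit.of_mul_eq_one (Ideal.Quotient.mk I c) ?_
  rw [← map_mul, ← map_one (Ideal.Quotient.mk I), Ideal.Quotient.mk_eq_mk_iff_sub_mem, ← hab]
  simpa using I.neg_mem ha

theorem exists_pos_pow_eq_one {Q : Type*} [CommRing Q] [Finite Q] {u : Q} (hu : IsUnit u) :
    ∃ n, 0 < n ∧ u ^ n = 1 := by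
  obtain ⟨v, rfl⟩ := hu
  refine ⟨orderOf v, orderOf_pos v, ?_⟩
  rw [← Units.val_pow_eq_pow_val, pow_orderOf_eq_one, Units.val_one]

/-- For an `f`-decomposition `I = I₁ I₂`, the cycle lengths modulo `I` are those modulo `I₁`. -/
theorem IsFDecomposition.cycleSet_eq_range {f : S} {I I₁ I₂ : Ideal S} [Finite (S ⧸ I)]
    (hd : IsFDecomposition f I I₁ I₂) :
    cycleSet (mulSystem f I) = Set.range (Function.minimalPeriod (mulSystem f I₁)) := by
  have hle : I ≤ I₁ := hd.eq_mul ▸ Ideal.mul_le_left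
  have : Finite (S ⧸ I₁) := Finite.of_surjective _ (Ideal.Quotient.factor_surjective hle)
  obtain ⟨k, hk⟩ := hd.mem_radical
  have key (g : S) (hg : Ideal.Quotient.mk I g ∈ Function.periodicPts (mulSystem f I)) (n : ℕ) :
      (f ^ n - 1) * g ∈ I ↔ (f ^ n - 1) * g ∈ I₁ := by
    refine ⟨fun h => hle h, fun h => ?_⟩
    obtain ⟨l, hl, hp⟩ := hg
    have h1 : Function.IsPeriodicPt (mulSystem f I) (l * k) (Ideal.Quotient.mk I g) :=
      hp.mul_const k
    rw [isPeriodicPt_mulSystem_iff, ← map_pow, ← map_one (Ideal.Quotient.mk I), ← map_sub,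
      ← map_mul, Ideal.Quotient.eq_zero_iff_mem] at h1
    -- As `l > 0`, `f ^ (l * k)` lies in `I₂` and moves an element of `I₁` into `I`; the period `l *
    -- k` of `g` then removes this factor.
    have h2 : f ^ (l * k) * ((f ^ n - 1) * g) ∈ I := by
      rw [hd.eq_mul, mul_comm (f ^ (l * k))]
      refine Ideal.mul_mem_mul h ?_
      rw [mul_comm l k, pow_mul]
      exact Ideal.pow_mem_of_mem _ hk l hl
    have h3 := I.sub_mem h2 (I.mul_mem_left (f ^ n - 1) h1)
    convert h3 using 1
    ring
  have key' (g : S) (hg : Ideal.Quotient.mk I g ∈ Function.periodicPts (mulSystem f I)) :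
      Function.minimalPeriod (mulSystem f I) (Ideal.Quotient.mk I g) =
        Function.minimalPeriod (mulSystem f I₁) (Ideal.Quotient.mk I₁ g) := by
    refine Nat.dvd_right_iff_eq.1 fun n => ?_
    rw [minimalPeriod_mulSystem_mk_dvd_iff, minimalPeriod_mulSystem_mk_dvd_iff, key g hg]
  rw [cycleSet_eq_image]
  apply Set.Subset.antisymm
  · rintro _ ⟨x, hx, rfl⟩
    obtain ⟨g, rfl⟩ := Ideal.Quotient.mk_surjective x
    exact ⟨_, (key' g hx).symm⟩
  · rintro _ ⟨y, rfl⟩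
    obtain ⟨g, rfl⟩ := Ideal.Quotient.mk_surjective y
    -- `g` itself need not be periodic modulo `I`. A suitable power of `f ^ n`, with `f ^ n = 1`
    -- modulo `I₁`, makes it periodic without changing its class modulo `I₁`.
    obtain ⟨n, hn, hfn⟩ := exists_pos_pow_eq_one (isUnit_mk_of_sup_eq_top hd.coprime)
    obtain ⟨a, b, hab, h⟩ := Finite.exists_ne_map_eq_of_infinite
      (fun i : ℕ => Ideal.Quotient.mk I (f ^ (n * i)))
    wlog hlt : a < b generalizing a b
    · exact this b a hab.symm h.symm (lt_of_le_of_ne (not_lt.1 hlt) hab.symm)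
    have hper : Ideal.Quotient.mk I (f ^ (n * a) * g) ∈ Function.periodicPts (mulSystem f I) := by
      refine Function.mk_mem_periodicPts (n := n * (b - a))
        (Nat.mul_pos hn (Nat.sub_pos_of_lt hlt)) ?_
      rw [isPeriodicPt_mulSystem_iff, map_mul, ← mul_assoc, sub_mul, one_mul, ← map_pow, ← map_mul,
        ← pow_add, ← mul_add, Nat.sub_add_cancel hlt.le]
      rw [h, sub_self, zero_mul]
    refine ⟨_, hper, ?_⟩
    rw [key' _ hper, map_mul, map_pow, pow_mul, hfn, one_pow, one_mul]

/-- Chinese remaindering of cycle lengths. -/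
theorem range_minimalPeriod_iInf {J : Type*} [Fintype J] (f : S) (I : J → Ideal S)
    (hI : Pairwise (Function.onFun IsCoprime I)) :
    Set.range (Function.minimalPeriod (mulSystem f (⨅ j, I j))) =
      bigLcmProd Finset.univ fun j => Set.range (Function.minimalPeriod (mulSystem f (I j))) := by
  have key (g : S) :
      Function.minimalPeriod (mulSystem f (⨅ j, I j)) (Ideal.Quotient.mk _ g) =
        Finset.univ.lcm fun j =>
          Function.minimalPeriod (mulSystem f (I j)) (Ideal.Quotient.mk _ g) := by
    refine Nat.dvd_right_iff_eq.1 fun n => ?_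
    simp [Finset.lcm_dvd_iff, minimalPeriod_mulSystem_mk_dvd_iff]
  apply Set.Subset.antisymm
  · rintro _ ⟨x, rfl⟩
    obtain ⟨g, rfl⟩ := Ideal.Quotient.mk_surjective x
    exact ⟨_, fun j _ => ⟨_, rfl⟩, key g⟩
  · rintro _ ⟨a, ha, rfl⟩
    choose x hx using fun j => ha j (Finset.mem_univ j)
    choose y hy using fun j => Ideal.Quotient.mk_surjective (x j)
    obtain ⟨g, hg⟩ := Ideal.exists_forall_sub_mem_ideal hI y
    refine ⟨Ideal.Quotient.mk _ g, (key g).trans (Finset.lcm_congr rfl fun j _ => ?_)⟩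
    rw [← hx j, ← hy j, Ideal.Quotient.mk_eq_mk_iff_sub_mem _ _ |>.2 (hg j)]

end MulSystem

/-! ## Unipotent elements in a ring where `p` is nilpotent -/

section Unipotent

variable {Q : Type*} [CommRing Q] {p : ℕ}

/-- A large `p`-power exponent kills `u - 1` up to a multiple of `p`; each further `p`-th power
gains a factor `p`, until the power of `p` vanishes. -/
theorem exists_pow_prime_pow_eq_one (hp : p.Prime) (hpn : IsNilpotent (p : Q)) {u : Q}
    (hu : IsNilpotent (u - 1)) : ∃ K, u ^ p ^ K = 1 := by
  obtain ⟨a, ha⟩ := hu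
  obtain ⟨b, hb⟩ := hpn
  obtain ⟨r, hr⟩ := exists_add_pow_prime_pow_eq hp (u - 1) 1 a
  have h0 : (u - 1) ^ p ^ a = 0 :=
    pow_eq_zero_of_le (Nat.lt_pow_self hp.one_lt).le ha
  have h1 : (p : Q) ∣ u ^ p ^ a - 1 := by
    rw [sub_add_cancel, h0, one_pow, zero_add] at hr
    rw [hr]
    exact ⟨(u - 1) * r, by ring⟩
  have h2 := dvd_sub_pow_of_dvd_sub h1 b
  rw [pow_succ, hb, zero_mul, zero_dvd_iff, one_pow, ← pow_mul, ← pow_add, sub_eq_zero] at h2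
  exact ⟨_, h2⟩

/-- A nontrivial unipotent element has an orbit of length exactly `p`. -/
theorem exists_orbit_of_prime_length (hp : p.Prime) (hpn : IsNilpotent (p : Q)) {u : Q}
    (hu : IsNilpotent (u - 1)) (hu1 : u ≠ 1) : ∃ w : Q, (u - 1) * w ≠ 0 ∧ (u ^ p - 1) * w = 0 := by
  classical
  have hy : u - 1 ≠ 0 := sub_ne_zero.2 hu1
  have hQ : Nontrivial Q := ⟨_, _, hu1⟩
  set y := u - 1 with hydef
  have ha := Nat.find_spec hu
  have hmin := fun m => Nat.find_min hu (m := m)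
  set a := Nat.find hu
  have h2 : 2 ≤ a := by
    by_contra! h
    interval_cases a
    · simp at ha
    · exact hy (by simpa using ha)
  obtain ⟨c, hc⟩ := Nat.exists_eq_add_of_le' h2
  have hz : y * y ^ c ≠ 0 := by
    rw [← pow_succ']
    exact hmin (c + 1) (by omega)
  have hz2 : y ^ 2 * y ^ c = 0 := by rw [← pow_add, add_comm, ← hc, ha]
  have hex : ∃ b, (p : Q) ^ b * (y * y ^ c) = 0 := by
    obtain ⟨b, hb⟩ := hpn
    exact ⟨b, by rw [hb, zero_mul]⟩
  have hb := Nat.find_spec hex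
  have hbmin := fun m => Nat.find_min hex (m := m)
  set b := Nat.find hex
  have hb0 : b ≠ 0 := by
    intro h
    rw [h, pow_zero, one_mul] at hb
    exact hz hb
  obtain ⟨b', hb'⟩ := Nat.exists_eq_succ_of_ne_zero hb0
  -- Here `c = a - 2` and `b' = b - 1`, with `a` the nilpotency index of `y` and `b` least such that
  -- `p ^ b` kills `y ^ (a - 1)`. One factor `y` leaves this element nonzero, but both `y ^ p` and
  -- `p * y` annihilate it.
  refine ⟨(p : Q) ^ b' * y ^ c, ?_, ?_⟩
  · rw [mul_left_comm]
    exact hbmin b' (by omega)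
  · obtain ⟨r, hr⟩ := exists_add_pow_prime_eq hp y 1
    obtain ⟨q, hq⟩ := Nat.exists_eq_add_of_le' hp.two_le
    have hyp : y ^ p * y ^ c = 0 := by
      rw [hq, pow_add, mul_assoc, hz2, mul_zero]
    rw [show u = y + 1 by rw [hydef]; ring, hr]
    rw [hb', pow_succ] at hb
    linear_combination (p : Q) ^ b' * hyp + r * hb

/-- If `p ^ (s + 1) = 0` with `s ≥ 1`, then `(1 + p ^ s y) ^ p = 1`. -/
theorem pow_prime_eq_one_of_dvd (hp : p.Prime) {s : ℕ} (hs : 1 ≤ s) (hps : (p : Q) ^ (s + 1) = 0)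
    {u : Q} (hu : (p : Q) ^ s ∣ u - 1) : u ^ p = 1 := by
  obtain ⟨y, hy⟩ := hu
  obtain ⟨r, hr⟩ := exists_add_pow_prime_eq hp (u - 1) 1
  -- Uses `s * p ≥ s + 1`, which needs `s ≥ 1`.
  have h0 : (u - 1) ^ p = 0 := by
    rw [hy, mul_pow, ← pow_mul, pow_eq_zero_of_le _ hps, zero_mul]
    nlinarith [hp.two_le]
  rw [sub_add_cancel, h0, hy] at hr
  rw [hr]
  linear_combination y * r * hps

end Unipotent

/-! ## Cycle lengths of a component -/

section Component

variable {S : Type*} [CommRing S] {p d : ℕ} {f : S} {I : Ideal S}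

/-- Unipotence of `u ^ d` bounds the order by `d` times a power of `p`. The order is a multiple of
`d`, since otherwise `0` would be a unit. -/
theorem exists_orderOf_eq_mul_prime_pow {Q : Type*} [CommRing Q] [Nontrivial Q] {u : Q}
    (hp : p.Prime) (hpn : IsNilpotent (p : Q)) (hnil : IsNilpotent (u ^ d - 1))
    (hunit : ∀ n, ¬ d ∣ n → IsUnit (u ^ n - 1)) : ∃ M, orderOf u = d * p ^ M := by
  obtain ⟨K, hK⟩ := exists_pow_prime_pow_eq_one hp hpn hnil
  have h1 : orderOf u ∣ d * p ^ K := orderOf_dvd_of_pow_eq_one (by rw [pow_mul, hK])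
  have h2 : d ∣ orderOf u := by
    by_contra h
    have := hunit _ h
    rw [pow_orderOf_eq_one, sub_self] at this
    exact not_isUnit_zero this
  obtain ⟨c, hc⟩ := h2
  rcases Nat.eq_zero_or_pos d with hd | hd
  · exact ⟨0, by rw [hc, hd, zero_mul, zero_mul]⟩
  · rw [hc] at h1
    obtain ⟨M, -, rfl⟩ := (Nat.dvd_prime_pow hp).1 (Nat.dvd_of_mul_dvd_mul_left hd h1)
    exact ⟨M, hc⟩

/-- The cycle lengths of a component on which all residual orders equal `d`. -/
theorem range_minimalPeriod_component [Nontrivial (S ⧸ I)] (hp : p.Prime) (hd : 0 < d)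
    (hpn : IsNilpotent (p : S ⧸ I))
    (hnil : IsNilpotent (Ideal.Quotient.mk I f ^ d - 1))
    (hunit : ∀ n, ¬ d ∣ n → IsUnit (Ideal.Quotient.mk I f ^ n - 1)) {M : ℕ}
    (hM : orderOf (Ideal.Quotient.mk I f) = d * p ^ M) :
    Set.range (Function.minimalPeriod (mulSystem f I)) =
      {n | n = 1 ∨ ∃ s ≤ M, n = d * p ^ s} := by
  have hdvd (x : S ⧸ I) (hx : x ≠ 0) : d ∣ Function.minimalPeriod (mulSystem f I) x := by
    by_contra h
    have h1 := (minimalPeriod_mulSystem_dvd_iff f I _ x).1 dvd_rfl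
    exact hx ((hunit _ h).mul_right_eq_zero.1 h1)
  have hle (x : S ⧸ I) : Function.minimalPeriod (mulSystem f I) x ∣ d * p ^ M := by
    rw [minimalPeriod_mulSystem_dvd_iff, ← hM, pow_orderOf_eq_one, sub_self, zero_mul]
  have hform (x : S ⧸ I) (hx : x ≠ 0) (s : ℕ)
      (h : Function.minimalPeriod (mulSystem f I) x ∣ d * p ^ s) :
      ∃ t ≤ s, Function.minimalPeriod (mulSystem f I) x = d * p ^ t := by
    obtain ⟨c, hc⟩ := hdvd x hx
    rw [hc] at h ⊢
    obtain ⟨t, ht, rfl⟩ := (Nat.dvd_prime_pow hp).1 (Nat.dvd_of_mul_dvd_mul_left hd h)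
    exact ⟨t, ht, rfl⟩
  apply Set.Subset.antisymm
  · rintro _ ⟨x, rfl⟩
    by_cases hx : x = 0
    · left
      rw [← Nat.dvd_one, minimalPeriod_mulSystem_dvd_iff, hx, mul_zero]
    · exact Or.inr (hform x hx M (hle x))
  · rintro n (rfl | ⟨s, hs, rfl⟩)
    · refine ⟨0, ?_⟩
      rw [← Nat.dvd_one, minimalPeriod_mulSystem_dvd_iff, mul_zero]
    · cases s with
      | zero =>
        classical
        have ha := Nat.find_spec hnil
        have hmin := fun m => Nat.find_min hnil (m := m)
        set a := Nat.find hnil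
        have ha0 : a ≠ 0 := by
          intro h
          rw [h, pow_zero] at ha
          exact one_ne_zero ha
        obtain ⟨b, hb⟩ := Nat.exists_eq_succ_of_ne_zero ha0
        -- The last nonvanishing power of `f ^ d - 1` is a nonzero element fixed by `f ^ d`.
        refine ⟨(Ideal.Quotient.mk I f ^ d - 1) ^ b, ?_⟩
        obtain ⟨t, ht, h⟩ := hform _ (hmin b (by omega)) 0 (by
          rw [pow_zero, mul_one, minimalPeriod_mulSystem_dvd_iff, ← pow_succ', ← Nat.succ_eq_add_one, ← hb, ha])
        rw [h, Nat.le_zero.1 ht]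
      | succ s =>
        have hu1 : Ideal.Quotient.mk I f ^ (d * p ^ s) ≠ 1 := by
          intro h
          have h1 := orderOf_dvd_of_pow_eq_one h
          rw [hM] at h1
          have h2 := (Nat.pow_dvd_pow_iff_le_right hp.one_lt).1 (Nat.dvd_of_mul_dvd_mul_left hd h1)
          omega
        have hun : IsNilpotent (Ideal.Quotient.mk I f ^ (d * p ^ s) - 1) := by
          rw [pow_mul]
          obtain ⟨c, hc⟩ := sub_one_dvd_pow_sub_one (Ideal.Quotient.mk I f ^ d) (p ^ s)
          rw [hc]
          exact (Commute.all _ _).isNilpotent_mul_right hnil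
        -- The length of `w` divides `d * p ^ (s + 1)` but not `d * p ^ s`, which pins it down.
        obtain ⟨w, hw1, hw2⟩ := exists_orbit_of_prime_length hp hpn hun hu1
        have hw : w ≠ 0 := by
          rintro rfl
          exact hw1 (mul_zero _)
        rw [← pow_mul, mul_assoc, ← pow_succ] at hw2
        obtain ⟨t, ht, h⟩ := hform w hw (s + 1) ((minimalPeriod_mulSystem_dvd_iff _ _ _ _).2 hw2)
        refine ⟨w, ?_⟩
        rcases Nat.lt_or_ge t (s + 1) with hlt | hge
        · refine absurd ((minimalPeriod_mulSystem_dvd_iff _ _ _ _).1 ?_) hw1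
          rw [h]
          exact mul_dvd_mul_left _ (pow_dvd_pow _ (Nat.lt_succ_iff.1 hlt))
        · rw [h, le_antisymm ht hge]

end Component

/-! ## Combinatorics of lcm-products -/

section Lcm

variable {J : Type*} [Fintype J]

/-- The part prime to `p` depends only on the support `P`, the `p`-part only on the largest exponent
over `P`. Used in both directions, this allows exponents to be redistributed within the support. -/
theorem lcm_mul_prime_pow_dvd {p : ℕ} {d : J → ℕ} (hd : ∀ j, (d j).Coprime p) (P : J → Prop)
    [DecidablePred P] (s t : J → ℕ) (hst : ∀ j, P j → ∃ j', P j' ∧ s j ≤ t j') :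
    (Finset.univ.lcm fun j => if P j then d j * p ^ s j else 1) ∣
      Finset.univ.lcm fun j => if P j then d j * p ^ t j else 1 := by
  refine Finset.lcm_dvd fun j _ => ?_
  split_ifs with hj
  · have hdv (i : J) (hi : P i) : d i * p ^ t i ∣
        Finset.univ.lcm fun j => if P j then d j * p ^ t j else 1 := by
      have h := Finset.dvd_lcm (f := fun j => if P j then d j * p ^ t j else 1)
        (Finset.mem_univ i)
      rwa [if_pos hi] at h
    refine ((hd j).pow_right _).mul_dvd_of_dvd_of_dvd ((Dvd.intro _ rfl).trans (hdv j hj)) ?_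
    obtain ⟨j', hj', hle⟩ := hst j hj
    exact (pow_dvd_pow p hle).trans ((Dvd.intro_left _ rfl).trans (hdv j' hj'))
  · exact one_dvd _

theorem bigLcmProd_eq_union {p : ℕ} {d : J → ℕ} (hd : ∀ j, (d j).Coprime p) (M M' : J → ℕ)
    (hle : ∀ j, M' j ≤ M j) (hle' : ∀ j, M j ≤ M' j + 1) :
    bigLcmProd Finset.univ (fun j => {n | n = 1 ∨ ∃ s ≤ M j, n = d j * p ^ s}) =
      bigLcmProd Finset.univ (fun j => {n | n = 1 ∨ ∃ s ≤ M' j, n = d j * p ^ s}) ∪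
        bigLcmProd Finset.univ (fun j => {1, d j * p ^ M j}) := by
  classical
  apply Set.Subset.antisymm
  · rintro _ ⟨a, ha, rfl⟩
    have hs (j : J) : ∃ s, a j ≠ 1 → s ≤ M j ∧ a j = d j * p ^ s := by
      rcases ha j (Finset.mem_univ j) with h | ⟨s, hs, h⟩
      · exact ⟨0, fun h' => absurd h h'⟩
      · exact ⟨s, fun _ => ⟨hs, h⟩⟩
    choose s hs using hs
    have haeq : a = fun j => if a j ≠ 1 then d j * p ^ s j else 1 := by
      funext j
      split_ifs with h
      · exact (hs j h).2
      · exact not_not.1 h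
    have hlcm (t : J → ℕ) (h1 : ∀ j, a j ≠ 1 → ∃ j', a j' ≠ 1 ∧ s j ≤ t j')
        (h2 : ∀ j, a j ≠ 1 → ∃ j', a j' ≠ 1 ∧ t j ≤ s j') :
        Finset.univ.lcm a = Finset.univ.lcm fun j => if a j ≠ 1 then d j * p ^ t j else 1 := by
      conv_lhs => rw [haeq]
      exact Nat.dvd_antisymm (lcm_mul_prime_pow_dvd hd (fun j => a j ≠ 1) s t h1)
        (lcm_mul_prime_pow_dvd hd (fun j => a j ≠ 1) t s h2)
    by_cases hne : ∃ j, a j ≠ 1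
    · obtain ⟨jm, hjm, hmax⟩ := Finset.exists_max_image (Finset.univ.filter fun j => a j ≠ 1) s
        (by obtain ⟨j, hj⟩ := hne; exact ⟨j, by simpa using hj⟩)
      simp only [Finset.mem_filter, Finset.mem_univ, true_and] at hjm hmax
      by_cases hbig : ∃ j₁, a j₁ ≠ 1 ∧ s jm ≤ M' j₁
      · obtain ⟨j₁, hj₁, hsM⟩ := hbig
        left
        refine ⟨_, fun j _ => ?_, hlcm (fun j => if j = j₁ then s jm else 0) ?_ ?_⟩
        · simp only
          split_ifs with h h'
          · exact Or.inr ⟨s jm, h' ▸ hsM, rfl⟩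
          · exact Or.inr ⟨0, Nat.zero_le _, rfl⟩
          · exact Or.inl rfl
        · exact fun j hj => ⟨j₁, hj₁, by simpa using hmax j hj⟩
        · intro j hj
          refine ⟨jm, hjm, ?_⟩
          split_ifs
          · exact le_rfl
          · exact Nat.zero_le _
      -- Now `M' j < s jm` on the whole support, so `M j ≤ s jm ≤ M jm`: full exponents give the
      -- same maximum.
      · push Not at hbig
        right
        refine ⟨_, fun j _ => ?_, hlcm M ?_ ?_⟩
        · simp only
          split_ifs with h
          · exact Or.inr rfl
          · exact Or.inl rfl
        · exact fun j hj => ⟨jm, hjm, (hmax j hj).trans (hs jm hjm).1⟩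
        · exact fun j hj => ⟨jm, hjm, (hle' j).trans (hbig j hj)⟩
    · push Not at hne
      exact Or.inl ⟨a, fun j _ => Or.inl (hne j), rfl⟩
  · rintro n (⟨a, ha, rfl⟩ | ⟨a, ha, rfl⟩)
    · refine ⟨a, fun j hj => ?_, rfl⟩
      rcases ha j hj with h | ⟨s, hs, h⟩
      · exact Or.inl h
      · exact Or.inr ⟨s, hs.trans (hle j), h⟩
    · refine ⟨a, fun j hj => ?_, rfl⟩
      rcases ha j hj with h | h
      · exact Or.inl h
      · exact Or.inr ⟨M j, le_rfl, h⟩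

end Lcm

/-! ## Lifting along a surjection with nil kernel -/

section Lift

variable {R K : Type*} [CommRing R] [CommRing K] {φ : R →+* K}

theorem isNilpotent_of_map_eq_zero (hker : ∀ x, φ x = 0 → IsNilpotent x) {g : R[X]}
    (hg : g.map φ = 0) : IsNilpotent g := by
  refine Polynomial.isNilpotent_iff.2 fun i => hker _ ?_
  rw [← Polynomial.coeff_map, hg, Polynomial.coeff_zero]

/-- A lifted Bézout combination differs from 1 by a nilpotent, hence is a unit. -/
theorem isCoprime_of_map (hφ : Function.Surjective φ) (hker : ∀ x, φ x = 0 → IsNilpotent x)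
    {g q : R[X]} (h : IsCoprime (g.map φ) (q.map φ)) : IsCoprime g q := by
  obtain ⟨a, b, hab⟩ := h
  obtain ⟨a, rfl⟩ := Polynomial.map_surjective φ hφ a
  obtain ⟨b, rfl⟩ := Polynomial.map_surjective φ hφ b
  have h1 : IsNilpotent (a * g + b * q - 1) := isNilpotent_of_map_eq_zero hker (by
    rw [Polynomial.map_sub, Polynomial.map_add, Polynomial.map_mul, Polynomial.map_mul, hab,
      Polynomial.map_one, sub_self])
  obtain ⟨u, hu⟩ : IsUnit (a * g + b * q) := by
    simpa using h1.isUnit_add_one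
  refine ⟨↑u⁻¹ * a, ↑u⁻¹ * b, ?_⟩
  rw [mul_assoc, mul_assoc, ← mul_add, ← hu, Units.inv_mul]

theorem finite_quotient_span_monic [Finite R] {m : R[X]} (hm : m.Monic) :
    Finite (R[X] ⧸ Ideal.span {m}) :=
  have := hm.finite_quotient
  Module.finite_of_finite R

theorem isUnit_mk_span_of_isCoprime {g q : R[X]} (h : IsCoprime g q) :
    IsUnit (Ideal.Quotient.mk (Ideal.span {q}) g) := by
  obtain ⟨a, b, hab⟩ := h
  refine IsUnit.of_mul_eq_one (Ideal.Quotient.mk _ a) ?_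
  rw [← map_mul, ← map_one (Ideal.Quotient.mk _), Ideal.Quotient.mk_eq_mk_iff_sub_mem,
    Ideal.mem_span_singleton]
  exact ⟨-b, by linear_combination hab⟩

theorem polyOrder_dvd_iff {f g : R[X]} {n : ℕ} : polyOrder f g ∣ n ↔ g ∣ f ^ n - 1 := by
  rw [polyOrder, orderOf_dvd_iff_pow_eq_one, ← map_pow, ← map_one (Ideal.Quotient.mk _),
    Ideal.Quotient.mk_eq_mk_iff_sub_mem, Ideal.mem_span_singleton]

theorem IsFDecomposition.map {S T : Type*} [CommRing S] [CommRing T] (ψ : S →+* T) {f : S}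
    {I I₁ I₂ : Ideal S} (hd : IsFDecomposition f I I₁ I₂) :
    IsFDecomposition (ψ f) (I.map ψ) (I₁.map ψ) (I₂.map ψ) where
  eq_mul := by rw [hd.eq_mul, Ideal.map_mul]
  coprime := by
    rw [← Set.image_singleton, ← Ideal.map_span, ← Ideal.map_sup, hd.coprime, Ideal.map_top]
  mem_radical := by
    obtain ⟨k, hk⟩ := hd.mem_radical
    exact ⟨k, by rw [← map_pow]; exact Ideal.mem_map_of_mem ψ hk⟩

/-- The cycle lengths of multiplication by `f` modulo `m`, when the invertible part of `m` is a
product of coprime factors `θ j` with residual order `d j`. -/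
theorem cycleSet_eq_bigLcmProd [Finite R] {p : ℕ} (hp : p.Prime) (hφ : Function.Surjective φ)
    (hker : ∀ x, φ x = 0 → IsNilpotent x) (hpK : (p : K) = 0) {f m m₁ m₂ : R[X]} (hm : m.Monic)
    (hdec : IsFDecomposition f (Ideal.span {m}) (Ideal.span {m₁}) (Ideal.span {m₂}))
    {J : Type*} [Fintype J] {d : J → ℕ} (hd : ∀ j, 0 < d j) {θ : J → R[X]}
    (hθm : m₁ = ∏ j, θ j)
    (hcop : ∀ i j, i ≠ j → IsCoprime ((θ i).map φ) ((θ j).map φ))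
    (hnu : ∀ j, ¬ IsUnit ((θ j).map φ))
    (hdiv : ∀ j, ∃ k, (θ j).map φ ∣ (f.map φ ^ d j - 1) ^ k)
    (hun : ∀ j n, ¬ d j ∣ n → IsCoprime (f.map φ ^ n - 1) ((θ j).map φ)) :
    ∃ M : J → ℕ, (∀ j, polyOrder f (θ j) = d j * p ^ M j) ∧
      cycleSet (mulSystem f (Ideal.span {m})) =
        bigLcmProd Finset.univ fun j => {n | n = 1 ∨ ∃ s ≤ M j, n = d j * p ^ s} := by
  have hcop' (i j : J) (hij : i ≠ j) : IsCoprime (θ i) (θ j) :=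
    isCoprime_of_map hφ hker (hcop i j hij)
  have hpn (j : J) : IsNilpotent ((p : R[X] ⧸ Ideal.span {θ j})) := by
    obtain ⟨b, hb⟩ := hker (p : R) (by rw [map_natCast, hpK])
    refine ⟨b, ?_⟩
    have h := congrArg (fun x => Ideal.Quotient.mk (Ideal.span {θ j}) (C x)) hb
    simpa using h
  have hnil (j : J) : IsNilpotent (Ideal.Quotient.mk (Ideal.span {θ j}) f ^ d j - 1) := by
    obtain ⟨k, c, hc⟩ := hdiv j
    obtain ⟨c, rfl⟩ := Polynomial.map_surjective φ hφ c
    obtain ⟨l, hl⟩ : IsNilpotent ((f ^ d j - 1) ^ k - θ j * c) :=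
      isNilpotent_of_map_eq_zero hker (by simp [hc])
    refine ⟨k * l, ?_⟩
    have h := congrArg (Ideal.Quotient.mk (Ideal.span {θ j})) hl
    have h0 : Ideal.Quotient.mk (Ideal.span {θ j}) (θ j) = 0 :=
      Ideal.Quotient.eq_zero_iff_mem.2 (Ideal.mem_span_singleton_self _)
    simpa [h0, pow_mul] using h
  have hunit (j : J) (n : ℕ) (hn : ¬ d j ∣ n) :
      IsUnit (Ideal.Quotient.mk (Ideal.span {θ j}) f ^ n - 1) := by
    have h := isCoprime_of_map (g := f ^ n - 1) (q := θ j) hφ hker (by simpa using hun j n hn)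
    simpa using isUnit_mk_span_of_isCoprime h
  have hnt (j : J) : Nontrivial (R[X] ⧸ Ideal.span {θ j}) := by
    refine Ideal.Quotient.nontrivial_iff.2 fun h => hnu j ?_
    exact (Ideal.span_singleton_eq_top.1 h).map (Polynomial.mapRingHom φ)
  choose M hM using fun j => exists_orderOf_eq_mul_prime_pow hp (hpn j) (hnil j) (hunit j)
  have := finite_quotient_span_monic hm
  refine ⟨M, hM, ?_⟩
  rw [hdec.cycleSet_eq_range, hθm, ← Ideal.iInf_span_singleton hcop',
    range_minimalPeriod_iInf f _
      (fun i j hij => (Ideal.isCoprime_span_singleton_iff _ _).2 (hcop' i j hij))]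
  congr 1
  funext j
  exact range_minimalPeriod_component hp (hd j) (hpn j) (hnil j) (hunit j) (hM j)

end Lift

/-! ## Change of the exponent -/

section Exponent

variable {R R' : Type*} [CommRing R] [CommRing R'] {ρ : R →+* R'}

theorem polyOrder_map_dvd (f g : R[X]) : polyOrder (f.map ρ) (g.map ρ) ∣ polyOrder f g := by
  rw [polyOrder_dvd_iff]
  simpa using Polynomial.map_dvd ρ (polyOrder_dvd_iff.1 (dvd_refl (polyOrder f g)))

/-- If `n` is the order downstairs, then `f ^ n` is 1 plus a multiple of `p ^ s` modulo `g`, so one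
more `p`-th power gives 1. -/
theorem polyOrder_dvd_mul_polyOrder_map {p s : ℕ} (hp : p.Prime) (hs : 1 ≤ s)
    (hρ : Function.Surjective ρ) (hker : ∀ x, ρ x = 0 → (p : R) ^ s ∣ x)
    (hps : (p : R) ^ (s + 1) = 0) (f g : R[X]) :
    polyOrder f g ∣ polyOrder (f.map ρ) (g.map ρ) * p := by
  set n := polyOrder (f.map ρ) (g.map ρ) with hn
  obtain ⟨c, hc⟩ := polyOrder_dvd_iff.1 hn.symm.dvd
  obtain ⟨c, rfl⟩ := Polynomial.map_surjective ρ hρ c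
  have h1 : (p : R[X]) ^ s ∣ f ^ n - 1 - g * c := by
    have h : C ((p : R) ^ s) ∣ f ^ n - 1 - g * c := by
      refine (Polynomial.C_dvd_iff_dvd_coeff _ _).2 fun i => hker _ ?_
      rw [← Polynomial.coeff_map]
      simp [hc]
    simpa using h
  rw [polyOrder, orderOf_dvd_iff_pow_eq_one, pow_mul]
  refine pow_prime_eq_one_of_dvd hp hs ?_ ?_
  · have h := congrArg (fun x => Ideal.Quotient.mk (Ideal.span {g}) (C x)) hps
    simpa using h
  · have h := map_dvd (Ideal.Quotient.mk (Ideal.span {g})) h1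
    have h0 : Ideal.Quotient.mk (Ideal.span {g}) g = 0 :=
      Ideal.Quotient.eq_zero_iff_mem.2 (Ideal.mem_span_singleton_self _)
    simpa [h0] using h

end Exponent

/-! ## Residual orders -/

section Residual

variable {K : Type*} [CommRing K] {p : ℕ} {F : K[X]}

theorem polyOrder_pos {G : K[X]} [Finite (K[X] ⧸ Ideal.span {G})] (h : IsCoprime F G) :
    0 < polyOrder F G := by
  obtain ⟨n, hn, h1⟩ := exists_pos_pow_eq_one (isUnit_mk_span_of_isCoprime h)
  exact Nat.pos_of_dvd_of_pos (orderOf_dvd_of_pow_eq_one h1) hn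

theorem isCoprime_pow_sub_one_of_not_dvd [IsDomain K] [IsPrincipalIdealRing K[X]]
    {G : K[X]} (hG : Irreducible G) {n : ℕ}
    (hn : ¬ polyOrder F G ∣ n) : IsCoprime (F ^ n - 1) G :=
  (hG.coprime_iff_not_dvd.2 fun h => hn (polyOrder_dvd_iff.2 h)).symm

/-- By Frobenius, `F ^ (c * p) - 1 = (F ^ c - 1) ^ p`; the prime `G` would already divide `F ^ c -
1`, against minimality. -/
theorem polyOrder_coprime [IsDomain K] [IsPrincipalIdealRing K[X]]
    (hp : p.Prime) (hpK : (p : K) = 0) {G : K[X]} (hG : Irreducible G)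
    (hpos : 0 < polyOrder F G) : (polyOrder F G).Coprime p := by
  rw [Nat.coprime_comm, hp.coprime_iff_not_dvd]
  rintro ⟨c, hc⟩
  have h1 : G ∣ F ^ (c * p) - 1 := polyOrder_dvd_iff.1 (by rw [hc, mul_comm])
  have h2 : G ∣ (F ^ c - 1) ^ p := by
    obtain ⟨r, hr⟩ := exists_add_pow_prime_eq hp (F ^ c - 1) 1
    have hpX : (p : K[X]) = 0 := by rw [← Polynomial.C_eq_natCast, hpK, Polynomial.C_0]
    rw [sub_add_cancel, hpX, ← pow_mul] at hr
    convert h1 using 1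
    linear_combination -hr
  have h3 := polyOrder_dvd_iff.2 (hG.prime.dvd_of_dvd_pow h2)
  rw [hc] at h3
  have hc0 : 0 < c := Nat.pos_of_mul_pos_left (hc ▸ hpos)
  have := Nat.le_of_dvd hc0 h3
  nlinarith [hp.two_le]

variable [Fact p.Prime] {r : ℕ} {G : Fin r → K[X]} {k : Fin r → ℕ}

/-- The common order of `F` modulo the factors in a class. -/
noncomputable def classOrder (p : ℕ) [Fact p.Prime] (F : K[X]) (G : Fin r → K[X]) (j : OrderClass p F G) : ℕ :=
  polyOrder F (G j.out)

/-- Orders prime to `p` that differ by a power of `p` are equal, so the chosen representative is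
immaterial. -/
theorem polyOrder_eq_classOrder (hord : ∀ i, (polyOrder F (G i)).Coprime p) (i : Fin r) :
    polyOrder F (G i) = classOrder p F G (Quotient.mk _ i) := by
  have hrel : OrderEquiv p F (G i) (G (Quotient.out (Quotient.mk _ i : OrderClass p F G))) :=
    Quotient.exact (s := Setoid.comap G (orderSetoid p F)) (Quotient.out_eq _).symm
  have key {a b l : ℕ} (ha : a.Coprime p) (h : a = p ^ l * b) : a = b := by
    rcases Nat.eq_zero_or_pos l with rfl | hl
    · simpa using h
    · have : p ∣ a := h ▸ (dvd_pow_self p hl.ne').mul_right b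
      exact absurd ha.symm ((Fact.out : p.Prime).coprime_iff_not_dvd.not.2 (not_not.2 this))
  obtain ⟨l, h | h⟩ := hrel
  · exact key (hord i) h
  · exact (key (hord _) h).symm

theorem groupedFactor_dvd_pow (hord : ∀ i, (polyOrder F (G i)).Coprime p)
    (j : OrderClass p F G) :
    ∃ l, groupedFactor p F G k j ∣ (F ^ classOrder p F G j - 1) ^ l := by
  classical
  refine ⟨∑ i : Fin r with (Quotient.mk _ i : OrderClass p F G) = j, k i, ?_⟩
  rw [groupedFactor, ← Finset.prod_pow_eq_pow_sum]
  convert Finset.prod_dvd_prod_of_dvd _ _ fun i hi => ?_ using 1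
  refine pow_dvd_pow_of_dvd (polyOrder_dvd_iff.1 ?_) _
  rw [polyOrder_eq_classOrder hord, (Finset.mem_filter.1 hi).2]

theorem isCoprime_groupedFactor [IsDomain K] [IsPrincipalIdealRing K[X]]
    (hG : ∀ i, Irreducible (G i))
    (hord : ∀ i, (polyOrder F (G i)).Coprime p) (j : OrderClass p F G) {n : ℕ}
    (hn : ¬ classOrder p F G j ∣ n) : IsCoprime (F ^ n - 1) (groupedFactor p F G k j) := by
  classical
  refine IsCoprime.prod_right fun i hi => IsCoprime.pow_right ?_
  refine isCoprime_pow_sub_one_of_not_dvd (hG i) ?_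
  rwa [polyOrder_eq_classOrder hord, (Finset.mem_filter.1 hi).2]

theorem groupedFactor_not_isUnit (hG : ∀ i, Irreducible (G i)) (hk : ∀ i, 0 < k i)
    (j : OrderClass p F G) : ¬ IsUnit (groupedFactor p F G k j) := by
  classical
  intro h
  obtain ⟨i, rfl⟩ := Quotient.exists_rep j
  refine (hG i).not_isUnit (isUnit_of_dvd_unit ((dvd_pow_self (G i) (hk i).ne').trans ?_) h)
  exact Finset.dvd_prod_of_mem (fun i => G i ^ k i)
    (Finset.mem_filter.2 ⟨Finset.mem_univ i, rfl⟩)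

theorem groupedFactor_isCoprime (hcop : ∀ i i', i ≠ i' → IsCoprime (G i) (G i'))
    (j j' : OrderClass p F G) (hj : j ≠ j') :
    IsCoprime (groupedFactor p F G k j) (groupedFactor p F G k j') := by
  classical
  refine IsCoprime.prod_left fun i hi => IsCoprime.prod_right fun i' hi' => (hcop i i' ?_).pow
  rintro rfl
  exact hj ((Finset.mem_filter.1 hi).2.symm.trans (Finset.mem_filter.1 hi').2)

end Residual

/-! ## Galois rings -/

section Galois

variable (p : ℕ) (h : ℤ[X])

theorem galoisRing_finite [Fact p.Prime] (hmonic : h.Monic) (e : ℕ) :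
    Finite (GaloisRing p h e) := by
  have : NeZero ((p : ℤ) ^ e) := ⟨pow_ne_zero _
    (Int.natCast_ne_zero.2 (Fact.out : p.Prime).ne_zero)⟩
  have h1 := finite_quotient_span_monic
    (hmonic.map (Ideal.Quotient.mk (Ideal.span {(p : ℤ) ^ e})))
  have h2 : Ideal.map (AdjoinRoot.of h) (Ideal.span {(p : ℤ) ^ e}) =
      Ideal.span {(p : BaseRing h) ^ e} := by
    rw [Ideal.map_span, Set.image_singleton, map_pow, map_natCast]
  exact Finite.of_equiv _ ((AdjoinRoot.quotAdjoinRootEquivQuotPolynomialQuot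
    (Ideal.span {(p : ℤ) ^ e}) h).symm.trans (Ideal.quotEquivOfEq h2)).toEquiv

theorem galoisRing_natCast_pow (e : ℕ) : (p : GaloisRing p h e) ^ e = 0 := by
  have h1 : Ideal.Quotient.mk (Ideal.span {(p : BaseRing h) ^ e}) ((p : BaseRing h) ^ e) = 0 :=
    Ideal.Quotient.eq_zero_iff_mem.2 (Ideal.mem_span_singleton_self _)
  rwa [map_pow, map_natCast] at h1

theorem reduction_surjective {e' e : ℕ} (hle : e' ≤ e) :
    Function.Surjective (reduction p h hle) :=
  Ideal.Quotient.factor_surjective _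

theorem reduction_comp_canonicalHom {e' e : ℕ} (hle : e' ≤ e) :
    (reduction p h hle).comp (canonicalHom p h e) = canonicalHom p h e' :=
  Ideal.Quotient.factor_comp_mk _

theorem reduction_comp_reduction {e'' e' e : ℕ} (h₁ : e'' ≤ e') (h₂ : e' ≤ e) :
    (reduction p h h₁).comp (reduction p h h₂) = reduction p h (h₁.trans h₂) :=
  Ideal.Quotient.factor_comp _ _

theorem pow_dvd_of_reduction_eq_zero {e' e : ℕ} (hle : e' ≤ e) (x : GaloisRing p h e)
    (hx : reduction p h hle x = 0) : (p : GaloisRing p h e) ^ e' ∣ x := by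
  obtain ⟨y, rfl⟩ := Ideal.Quotient.mk_surjective x
  have hy : Ideal.Quotient.mk (Ideal.span {(p : BaseRing h) ^ e'}) y = 0 := hx
  rw [Ideal.Quotient.eq_zero_iff_mem, Ideal.mem_span_singleton] at hy
  simpa using map_dvd (canonicalHom p h e) hy

theorem isNilpotent_of_reduction_eq_zero {e' e : ℕ} (he' : 1 ≤ e') (hle : e' ≤ e)
    (x : GaloisRing p h e) (hx : reduction p h hle x = 0) : IsNilpotent x := by
  obtain ⟨y, rfl⟩ := pow_dvd_of_reduction_eq_zero p h hle x hx
  refine (Commute.all _ _).isNilpotent_mul_right ⟨e, ?_⟩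
  rw [← pow_mul]
  exact pow_eq_zero_of_le (Nat.le_mul_of_pos_left e he') (galoisRing_natCast_pow p h e)

/-- Interchanging the two quotients identifies `R / (p)` with `𝔽_p[t]` modulo the irreducible
reduction of `h`. -/
theorem galoisRing_one_isField [Fact p.Prime]
    (hirr : Irreducible (h.map (Int.castRingHom (ZMod p)))) : IsField (GaloisRing p h 1) := by
  have hpr : p.Prime := Fact.out
  have : (Ideal.span {(p : ℤ)}).IsMaximal :=
    PrincipalIdealRing.isMaximal_of_irreducible (Nat.prime_iff_prime_int.1 hpr).irreducible
  let := Ideal.Quotient.field (Ideal.span {(p : ℤ)})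
  let ε := Int.quotientSpanNatEquivZMod p
  have h1 : Irreducible (h.map (Ideal.Quotient.mk (Ideal.span {(p : ℤ)}))) := by
    rw [← MulEquiv.irreducible_iff (Polynomial.mapEquiv ε)]
    convert hirr using 1
    rw [Polynomial.mapEquiv_apply, Polynomial.map_map]
    congr 1
  have h2 : (Ideal.span {h.map (Ideal.Quotient.mk (Ideal.span {(p : ℤ)}))}).IsMaximal :=
    PrincipalIdealRing.isMaximal_of_irreducible h1
  have h3 : IsField ((ℤ ⧸ Ideal.span {(p : ℤ)})[X] ⧸
      Ideal.span {h.map (Ideal.Quotient.mk (Ideal.span {(p : ℤ)}))}) :=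
    (Ideal.Quotient.maximal_ideal_iff_isField_quotient _).1 h2
  have h4 := (AdjoinRoot.quotAdjoinRootEquivQuotPolynomialQuot
    (Ideal.span {(p : ℤ)}) h).toMulEquiv.isField h3
  have h5 : Ideal.map (AdjoinRoot.of h) (Ideal.span {(p : ℤ)}) =
      Ideal.span {(p : BaseRing h) ^ 1} := by
    rw [Ideal.map_span, Set.image_singleton, map_natCast, pow_one]
  exact (Ideal.quotEquivOfEq h5).symm.toMulEquiv.isField h4

theorem isPrincipalIdealRing_polynomial_of_isField {K : Type*} [CommRing K] (hK : IsField K) :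
    IsPrincipalIdealRing K[X] := by
  let := hK.toField
  infer_instance

end Galois

theorem mainTheorem10 (p : ℕ) [Fact p.Prime]
    -- the Galois rings `R_e = ℤ[t] / (h, p^e)`
    (h : ℤ[X]) (hmonic : h.Monic) (hirr : Irreducible (h.map (Int.castRingHom (ZMod p))))
    (e : ℕ) (he : 1 < e)
    (f m : (BaseRing h)[X]) (hm : m.Monic)
    (hf : 1 ≤ f.natDegree) (hfm : f.natDegree < m.natDegree)
    -- the `f`-decomposition `m = m₁ m₂` over `R_e`
    (m₁ m₂ : (GaloisRing p h e)[X]) (hmul : m.map (canonicalHom p h e) = m₁ * m₂)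
    (hdec : IsFDecomposition (f.map (canonicalHom p h e))
      (Ideal.span {m.map (canonicalHom p h e)}) (Ideal.span {m₁}) (Ideal.span {m₂}))
    -- the factorization of `m₁` modulo `p`
    (r : ℕ) (G : Fin r → (GaloisRing p h 1)[X]) (k : Fin r → ℕ)
    (hG : ∀ i, Irreducible (G i)) (hcop : ∀ i i', i ≠ i' → IsCoprime (G i) (G i'))
    (hk : ∀ i, 0 < k i)
    (hfac : m₁.map (reduction p h he.le) = ∏ i, G i ^ k i)
    -- the lifts `θ_j` of the grouped factors `Θ_j`
    (θ : OrderClass p (f.map (canonicalHom p h 1)) G → (GaloisRing p h e)[X])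
    (hθ : ∀ j, (θ j).map (reduction p h he.le) =
      groupedFactor p (f.map (canonicalHom p h 1)) G k j)
    (hθm : m₁ = ∏ j, θ j) :
    cycleSet (galoisSystem p h e f m) =
        cycleSet (galoisSystem p h (e - 1) f m) ∪
          bigLcmProd Finset.univ (fun j => {1, polyOrder (f.map (canonicalHom p h e)) (θ j)}) ∧
      Fintype.card (OrderClass p (f.map (canonicalHom p h 1)) G) ≤ r := by
  classical
  have hp : p.Prime := Fact.out
  have hK := galoisRing_one_isField p h hirr
  have : IsDomain (GaloisRing p h 1) := hK.isDomain
  have := isPrincipalIdealRing_polynomial_of_isField hK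
  have hfin := galoisRing_finite p h hmonic
  have he1 : 1 ≤ e - 1 := Nat.le_sub_one_of_lt he
  have hee : e - 1 ≤ e := Nat.sub_le e 1
  have hpK : (p : GaloisRing p h 1) = 0 := by simpa using galoisRing_natCast_pow p h 1
  have hfF : (f.map (canonicalHom p h e)).map (reduction p h he.le) =
      f.map (canonicalHom p h 1) := by
    rw [Polynomial.map_map, reduction_comp_canonicalHom]
  have hGdvd (i : Fin r) : G i ∣ m₁.map (reduction p h he.le) := by
    rw [hfac]
    exact (dvd_pow_self _ (hk i).ne').trans (Finset.dvd_prod_of_mem _ (Finset.mem_univ i))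
  have hGcop (i : Fin r) : IsCoprime (f.map (canonicalHom p h 1)) (G i) := by
    have h1 : IsCoprime m₁ (f.map (canonicalHom p h e)) := by
      rw [← Ideal.isCoprime_span_singleton_iff, Ideal.isCoprime_iff_sup_eq]
      exact hdec.coprime
    have h2 := (h1.map (Polynomial.mapRingHom (reduction p h he.le))).symm
    simp only [Polynomial.coe_mapRingHom, hfF] at h2
    exact h2.of_isCoprime_of_dvd_right (hGdvd i)
  -- `G i` need not be monic; finiteness comes from its dividing the monic reduction of `m`.
  have hGfin (i : Fin r) : Finite ((GaloisRing p h 1)[X] ⧸ Ideal.span {G i}) := by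
    have h1 := finite_quotient_span_monic (hm.map (canonicalHom p h 1))
    refine Finite.of_surjective _ (Ideal.Quotient.factor_surjective
      (Ideal.span_singleton_le_span_singleton.2 ((hGdvd i).trans
        (?_ : _ ∣ m.map (canonicalHom p h 1)))))
    rw [← reduction_comp_canonicalHom p h he.le, ← Polynomial.map_map, hmul, Polynomial.map_mul]
    exact Dvd.intro _ rfl
  have hpos (i : Fin r) : 0 < polyOrder (f.map (canonicalHom p h 1)) (G i) := polyOrder_pos (hGcop i)
  have hord (i : Fin r) : (polyOrder (f.map (canonicalHom p h 1)) (G i)).Coprime p :=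
    polyOrder_coprime hp hpK (hG i) (hpos i)
  -- One statement serves both `e` and `e - 1`: the remaining hypotheses concern only reductions
  -- modulo `p`, which are the same at both levels.
  have main (e' : ℕ) (he' : 1 ≤ e') (hle : e' ≤ e) :=
    cycleSet_eq_bigLcmProd (φ := reduction p h he') (d := classOrder p (f.map (canonicalHom p h 1)) G)
      (f := f.map (canonicalHom p h e')) (m := m.map (canonicalHom p h e'))
      (m₁ := m₁.map (reduction p h hle)) (m₂ := m₂.map (reduction p h hle))
      (θ := fun j => (θ j).map (reduction p h hle)) hp
      (reduction_surjective p h he') (isNilpotent_of_reduction_eq_zero p h le_rfl he') hpK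
      (hm.map _)
      (by
        have h1 := hdec.map (Polynomial.mapRingHom (reduction p h hle))
        simpa only [Ideal.map_span, Set.image_singleton, Polynomial.coe_mapRingHom,
          Polynomial.map_map, reduction_comp_canonicalHom] using h1)
      (fun j => hpos _)
      (by rw [hθm, Polynomial.map_prod])
  simp only [Polynomial.map_map, reduction_comp_reduction, reduction_comp_canonicalHom, hθ] at main
  have main' (e' : ℕ) (he' : 1 ≤ e') (hle : e' ≤ e) := main e' he' hle
    (groupedFactor_isCoprime hcop) (groupedFactor_not_isUnit hG hk) (groupedFactor_dvd_pow hord)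
    (fun j n hn => isCoprime_groupedFactor hG hord j hn)
  obtain ⟨M, hM, hC⟩ := main' e he.le le_rfl
  obtain ⟨M', hM', hC'⟩ := main' (e - 1) he1 hee
  have hid : reduction p h (le_refl e) = RingHom.id _ := Ideal.Quotient.ringHom_ext rfl
  simp only [hid, Polynomial.map_id] at hM
  have hdpos (j : OrderClass p (f.map (canonicalHom p h 1)) G) : 0 < classOrder p (f.map (canonicalHom p h 1)) G j := hpos _
  have hmapf : f.map (canonicalHom p h (e - 1)) =
      (f.map (canonicalHom p h e)).map (reduction p h hee) := by
    rw [Polynomial.map_map, reduction_comp_canonicalHom]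
  refine ⟨?_, ?_⟩
  · rw [galoisSystem, galoisSystem, hC, hC']
    simp only [hM]
    refine bigLcmProd_eq_union (fun j => hord _) M M' (fun j => ?_) (fun j => ?_)
    · have h1 := polyOrder_map_dvd (ρ := reduction p h hee) (f.map (canonicalHom p h e)) (θ j)
      rw [← hmapf, hM, hM'] at h1
      exact (Nat.pow_dvd_pow_iff_le_right hp.one_lt).1 (Nat.dvd_of_mul_dvd_mul_left (hdpos j) h1)
    -- Taken with `s = e - 1`; the requirement `s ≥ 1` is where `e > 1` enters.
    · have h1 := polyOrder_dvd_mul_polyOrder_map hp he1 (reduction_surjective p h hee)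
        (pow_dvd_of_reduction_eq_zero p h hee)
        (by rw [Nat.sub_add_cancel he.le]; exact galoisRing_natCast_pow p h e)
        (f.map (canonicalHom p h e)) (θ j)
      rw [← hmapf, hM, hM', mul_assoc, ← pow_succ] at h1
      exact (Nat.pow_dvd_pow_iff_le_right hp.one_lt).1 (Nat.dvd_of_mul_dvd_mul_left (hdpos j) h1)
  · have h1 := Fintype.card_le_of_surjective _
      (Quotient.mk_surjective (s := Setoid.comap G (orderSetoid p (f.map (canonicalHom p h 1)))))
    simpa using h1
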